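/- For a bounded linear operator $T$ on a Banach space $X$ write $A\leftrightarrow B$ when $AB=BA$, and call an operator non-scalar if it is not a scalar multiple of the identity. $T$ is of chain $0$ if it is compact, of chain $1$ if it commutes with a non-zero compact operator, and of chain $N\ge 2$ if there are non-scalar bounded operators $S_1,\dots,S_{N-1}$ and a non-zero compact operator $K$ on $X$ with $$T\leftrightarrow S_1\leftrightarrow S_2\leftrightarrow\cdots\leftrightarrow S_{N-1}\leftrightarrow K .$$ $T$ is of minimal chain $N$ if it is of chain $N$ and of chain $k$ for no $k\in\{0,\dots,N-1\}$. $T$ is a Lomonosov operator if there are a non-scalar bounded operator $S$ and a non-zero compact operator $K$ with $T\leftrightarrow S\leftrightarrow K$. For a sequence $\beta=(\beta_n)_{n\ge 0}$ of positive numbers with $\beta_0=1$ let $H^2(\beta)$ be the Hilbert space of formal power series $f=\sum_{n\ge0}a_nz^n$ with complex coefficients such that $(\beta_na_n)_n\in\ell_2$, with inner product $\langle \sum a_nz^n,\sum b_nz^n\rangle=\sum_n a_n\overline{b_n}\,\beta_n^2$, and let $M_z$ be the multiplication operator $\sum a_nz^n\mapsto\sum a_nz^{n+1}$. **Theorem.**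 For every $\beta$ such that $M_z$ is a bounded operator on $H^2(\beta)$ and is not a Lomonosov operator, $M_z$ is of minimal chain $3$. Moreover, for $\beta_n=e^{\sqrt n}$ the operator $M_z$ is bounded on $H^2(\beta)$ and is not a Lomonosov operator, and hence it is of minimal chain $3$. -/

import Mathlib

noncomputable section

open scoped PowerSeries ComplexConjugate

/-! ### Chains of commuting operators -/

section Chains

variable {𝕜 X : Type*} [RCLike 𝕜] [NormedAddCommGroup X] [NormedSpace 𝕜 X]

/-- `S` is not a scalar multiple of the identity. -/
def IsNonScalar (S : X →L[𝕜] X) : Prop :=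
  ∀ c : 𝕜, S ≠ c • ContinuousLinearMap.id 𝕜 X

/-- `T` commutes with a non-scalar operator which commutes with a non-zero compact operator. -/
def IsLomonosov (T : X →L[𝕜] X) : Prop :=
  ∃ S K : X →L[𝕜] X, IsNonScalar S ∧ K ≠ 0 ∧ IsCompactOperator K ∧ Commute T S ∧ Commute S K

/-- `IsOfChain T N`: the operator `T` is of chain `N`. For `N = n + 2` the intermediate non-scalar
operators `S₁, …, S_{N-1}` are indexed by `Fin (n + 1)`. -/
def IsOfChain (T : X →L[𝕜] X) : ℕ → Prop
  | 0 => IsCompactOperator T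
  | 1 => ∃ K : X →L[𝕜] X, K ≠ 0 ∧ IsCompactOperator K ∧ Commute T K
  | n + 2 => ∃ (S : Fin (n + 1) → (X →L[𝕜] X)) (K : X →L[𝕜] X),
      (∀ i, IsNonScalar (S i)) ∧ K ≠ 0 ∧ IsCompactOperator K ∧
      Commute T (S 0) ∧
      (∀ i : Fin n, Commute (S i.castSucc) (S i.succ)) ∧
      Commute (S (Fin.last n)) K

/-- `T` is of chain `N`, and of chain `k` for no `k < N`. -/
def IsOfMinimalChain (T : X →L[𝕜] X) (N : ℕ) : Prop :=
  IsOfChain T N ∧ ∀ k < N, ¬ IsOfChain T k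

end Chains

/-! ### Weighted Hardy spaces -/

/-- A sequence of positive numbers `β₀, β₁, …` with `β₀ = 1`. -/
structure HardyWeight where
  /-- the underlying sequence -/
  seq : ℕ → ℝ
  pos : ∀ n, 0 < seq n
  seq_zero : seq 0 = 1

/-- The space `H²(β)` of formal power series `∑ aₙ zⁿ` with complex coefficients
such that `(βₙ aₙ)` is in `ℓ²`. -/
def HardySpace (β : HardyWeight) : Submodule ℂ ℂ⟦X⟧ where
  carrier := {f | Memℓp (fun n => (β.seq n : ℂ) * PowerSeries.coeff n f) 2}
  add_mem' := by
    intro f g hf hg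
    have h := Memℓp.add hf hg
    have e : (fun n => (β.seq n : ℂ) * PowerSeries.coeff n (f + g)) =
        (fun n => (β.seq n : ℂ) * PowerSeries.coeff n f) +
          (fun n => (β.seq n : ℂ) * PowerSeries.coeff n g) := by
      funext n
      simp [mul_add]
    change Memℓp _ 2
    rw [e]
    exact h
  zero_mem' := by
    have h : Memℓp (0 : (n : ℕ) → ℂ) 2 := zero_memℓp
    have e : (fun n => (β.seq n : ℂ) * PowerSeries.coeff n (0 : ℂ⟦X⟧)) = 0 := by
      funext n
      simp
    change Memℓp _ 2
    rw [e]
    exact h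
  smul_mem' := by
    intro c f hf
    have h := Memℓp.const_smul hf c
    have e : (fun n => (β.seq n : ℂ) * PowerSeries.coeff n (c • f)) =
        c • (fun n => (β.seq n : ℂ) * PowerSeries.coeff n f) := by
      funext n
      simp [mul_left_comm]
    change Memℓp _ 2
    rw [e]
    exact h

namespace HardySpace

variable (β : HardyWeight)

/-- The linear map `∑ aₙ zⁿ ↦ (βₙ aₙ)` from `H²(β)` to `ℓ²`. -/
def toEll2 : HardySpace β →ₗ[ℂ] lp (fun _ : ℕ => ℂ) 2 where
  toFun f := ⟨fun n => (β.seq n : ℂ) * PowerSeries.coeff n (f : ℂ⟦X⟧), f.2⟩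
  map_add' f g := by
    ext n
    change (β.seq n : ℂ) * PowerSeries.coeff n ((f : ℂ⟦X⟧) + (g : ℂ⟦X⟧)) =
      (β.seq n : ℂ) * PowerSeries.coeff n (f : ℂ⟦X⟧) +
        (β.seq n : ℂ) * PowerSeries.coeff n (g : ℂ⟦X⟧)
    rw [map_add, mul_add]
  map_smul' c f := by
    ext n
    simp [mul_left_comm]

theorem toEll2_apply (f : HardySpace β) (n : ℕ) :
    (toEll2 β f : ℕ → ℂ) n = (β.seq n : ℂ) * PowerSeries.coeff n (f : ℂ⟦X⟧) := rfl

theorem toEll2_injective : Function.Injective (toEll2 β) := by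
  intro f g h
  apply Subtype.ext
  ext n
  have hn : (toEll2 β f : ℕ → ℂ) n = (toEll2 β g : ℕ → ℂ) n := by rw [h]
  rw [toEll2_apply, toEll2_apply] at hn
  exact mul_left_cancel₀ (Complex.ofReal_ne_zero.mpr (β.pos n).ne') hn

theorem toEll2_surjective : Function.Surjective (toEll2 β) := by
  intro x
  have hb : ∀ n, (β.seq n : ℂ) ≠ 0 := fun n => Complex.ofReal_ne_zero.mpr (β.pos n).ne'
  have e : (fun n => (β.seq n : ℂ) *
      PowerSeries.coeff n (PowerSeries.mk fun k => (β.seq k : ℂ)⁻¹ * x k)) = x := by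
    funext n
    rw [PowerSeries.coeff_mk, mul_inv_cancel_left₀ (hb n)]
  have hm : PowerSeries.mk (fun k => (β.seq k : ℂ)⁻¹ * x k) ∈ HardySpace β := by
    change Memℓp _ 2
    rw [e]
    exact lp.memℓp x
  exact ⟨⟨_, hm⟩, Subtype.ext e⟩

/-- The norm of `H²(β)` is the `ℓ²` norm of `(βₙ aₙ)`. -/
instance : NormedAddCommGroup (HardySpace β) :=
  NormedAddCommGroup.induced (HardySpace β) (lp (fun _ : ℕ => ℂ) 2) (toEll2 β)
    (toEll2_injective β)

/-- The inner product of `H²(β)`; see `HardySpace.inner_eq_tsum` for the formula. -/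
instance : InnerProductSpace ℂ (HardySpace β) where
  norm_smul_le c f := by
    change ‖toEll2 β (c • f)‖ ≤ ‖c‖ * ‖toEll2 β f‖
    rw [map_smul]
    exact norm_smul_le c _
  inner f g := inner ℂ (toEll2 β f) (toEll2 β g)
  norm_sq_eq_re_inner f := norm_sq_eq_re_inner (𝕜 := ℂ) (toEll2 β f)
  conj_inner_symm f g := inner_conj_symm (𝕜 := ℂ) (toEll2 β f) (toEll2 β g)
  add_left f g h := by
    rw [map_add]
    exact inner_add_left _ _ _
  smul_left f g c := by
    rw [map_smul]
    exact inner_smul_left _ _ _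

/-- `⟨f, g⟩ = ∑ aₙ * conj bₙ * βₙ²`, where Mathlib's `inner` is conjugate linear in its first
argument. -/
theorem inner_eq_tsum (f g : HardySpace β) :
    inner ℂ g f = ∑' n, PowerSeries.coeff n (f : ℂ⟦X⟧) *
      conj (PowerSeries.coeff n (g : ℂ⟦X⟧)) * (β.seq n : ℂ) ^ 2 := by
  change inner ℂ (toEll2 β g) (toEll2 β f) = _
  rw [lp.inner_eq_tsum]
  refine tsum_congr fun n => ?_
  rw [toEll2_apply, toEll2_apply, RCLike.inner_apply, map_mul, Complex.conj_ofReal]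
  ring

/-- `H²(β)` is a Hilbert space. -/
instance : CompleteSpace (HardySpace β) := by
  have hi : Isometry (toEll2 β) := AddMonoidHomClass.isometry_of_norm (toEll2 β) fun _ => rfl
  rw [completeSpace_iff_isComplete_range hi.isUniformInducing, (toEll2_surjective β).range_eq]
  exact isComplete_univ

end HardySpace

/-- The bounded operator `M` on `H²(β)` is the multiplication operator `M_z`, `f ↦ z f`. -/
def IsMulByZ {β : HardyWeight} (M : HardySpace β →L[ℂ] HardySpace β) : Prop :=
  ∀ f : HardySpace β, ((M f : HardySpace β) : ℂ⟦X⟧) = PowerSeries.X * (f : ℂ⟦X⟧)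

/-- The weight `βₙ = exp (√n)`. -/
def expSqrtWeight : HardyWeight where
  seq n := Real.exp (Real.sqrt n)
  pos _ := Real.exp_pos _
  seq_zero := by simp

end

/-!
# Weighted shifts of minimal chain three

For every weight, `M_z ↔ M_z² ↔ P ↔ K` is a chain of length three, where `P` is the projection onto
the even power series and `K` the projection onto the constants. Chains of length at most two make
the non-scalar operator `M_z` a Lomonosov operator, so the first half is immediate.

For `βₙ = exp √n` the space `H²(β)` is a Banach algebra of functions that are `C¹` on the closed unit
disc, with the closed disc as its character space (`HardySpace.mulL`, `HardySpace.isUnit_mulL`).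
The commutant of `M_z` consists of the multiplication operators `M_φ`
(`HardySpace.eq_mulL_of_commute`), so one has to show that a compact `K` commuting with `M_φ`, where
`φ` is not constant, is zero (`HardySpace.eq_zero_of_commute_mulL`).

Suppose `K f₀ ≠ 0`. The image of the open disc under `φ` is open, whereas the boundary values of `φ`
form a curve of Hausdorff dimension at most one. Hence (`HardySpace.exists_generic_fibre`) there is a
value `c` of `φ` in the disc which `φ` does not take on the circle, and whose finite fibre `W`
consists of simple points at which `K f₀` does not vanish. By invertibility of zero-free functions,
the functions vanishing on `W` are exactly the multiples of `φ - c`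
(`HardySpace.exists_eq_sub_C_mul`), so that every operator commuting with `M_φ` acts on the values at
`W` by a finite matrix.

If that operator is compact, the diagonal of its matrix is zero
(`HardySpace.value_lagrange_diag_eq_zero`): otherwise a compact operator commuting with `M_φ` would
have a non-zero eigenvalue, by the Fredholm alternative, and `M_φ` would have an eigenvector in the
finite-dimensional eigenspace, which is impossible. Products `L M_g L'` with Lagrange polynomials `g`
show that having a non-zero matrix entry for some compact operator commuting with `M_φ` is a
transitive relation on `W`. It is thus a strict order on a finite set, but the matrix of `K` has no
zero row, since `K f₀` does not vanish on `W`: a contradiction.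
-/

noncomputable section

open scoped PowerSeries
open PowerSeries (coeff)
open Filter Topology Finset

/-! ### Coefficients, monomials and reindexing operators -/

namespace HardySpace

variable {β : HardyWeight}

theorem mem_iff {f : ℂ⟦X⟧} :
    f ∈ HardySpace β ↔ Summable fun n => (β.seq n * ‖coeff n f‖) ^ 2 := by
  change Memℓp _ 2 ↔ _
  rw [memℓp_gen_iff (by norm_num)]
  refine summable_congr fun n => ?_
  simp [abs_of_pos (β.pos n)]

theorem summable_sq (f : HardySpace β) :
    Summable fun n => (β.seq n * ‖coeff n (f : ℂ⟦X⟧)‖) ^ 2 :=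
  mem_iff.mp f.2

theorem norm_sq_eq_tsum (f : HardySpace β) :
    ‖f‖ ^ 2 = ∑' n, (β.seq n * ‖coeff n (f : ℂ⟦X⟧)‖) ^ 2 := by
  have h := lp.norm_rpow_eq_tsum (p := 2) (by norm_num) (toEll2 β f)
  have e : ‖f‖ = ‖toEll2 β f‖ := rfl
  rw [e]
  simpa [toEll2_apply, abs_of_pos (β.pos _)] using h

theorem norm_coeff_le (f : HardySpace β) (n : ℕ) :
    ‖coeff n (f : ℂ⟦X⟧)‖ ≤ (β.seq n)⁻¹ * ‖f‖ := by
  rw [← div_eq_inv_mul, le_div_iff₀ (β.pos n), mul_comm]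
  refine le_of_sq_le_sq ?_ (norm_nonneg f)
  rw [norm_sq_eq_tsum]
  exact (summable_sq f).le_tsum n fun _ _ => sq_nonneg _

/-- The coefficient functional `∑ aₖ zᵏ ↦ aₙ`. -/
def coeffL (n : ℕ) : HardySpace β →L[ℂ] ℂ :=
  ((coeff n : ℂ⟦X⟧ →ₗ[ℂ] ℂ).comp (HardySpace β).subtype).mkContinuous (β.seq n)⁻¹
    fun f => norm_coeff_le f n

@[simp]
theorem coeffL_apply (n : ℕ) (f : HardySpace β) : coeffL n f = coeff n (f : ℂ⟦X⟧) := rfl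

/-- A polynomial, as an element of `H²(β)`. -/
def ofPolynomial (p : Polynomial ℂ) : HardySpace β :=
  ⟨p, mem_iff.mpr <| summable_of_ne_finset_zero (s := p.support) fun n hn => by
    simp [Polynomial.notMem_support_iff.mp hn]⟩

@[simp]
theorem coe_ofPolynomial (p : Polynomial ℂ) :
    ((ofPolynomial p : HardySpace β) : ℂ⟦X⟧) = p := rfl

theorem hasSum_monomial (f : HardySpace β) :
    HasSum (fun n => coeff n (f : ℂ⟦X⟧) • (ofPolynomial (Polynomial.X ^ n) : HardySpace β)) f := by
  let e : HardySpace β ≃ₗᵢ[ℂ] lp (fun _ : ℕ => ℂ) 2 :=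
    ⟨LinearEquiv.ofBijective (toEll2 β) ⟨toEll2_injective β, toEll2_surjective β⟩, fun _ => rfl⟩
  have h := (lp.hasSum_single (p := 2) (by norm_num) (e f)).mapL
    (e.symm.toContinuousLinearEquiv : lp (fun _ : ℕ => ℂ) 2 →L[ℂ] HardySpace β)
  have h1 : HasSum (fun n => e.symm (lp.single 2 n (e f n))) (e.symm (e f)) := h
  rw [e.symm_apply_apply] at h1
  convert h1 using 2 with n
  rw [LinearIsometryEquiv.eq_symm_apply]
  apply Subtype.ext
  funext k
  have h2 : (e f : ℕ → ℂ) n = β.seq n * coeff n (f : ℂ⟦X⟧) := rfl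
  change (β.seq k : ℂ) * coeff k (coeff n (f : ℂ⟦X⟧) • ((Polynomial.X ^ n : Polynomial ℂ) : ℂ⟦X⟧))
    = _
  rw [h2]
  by_cases hk : k = n
  · subst hk
    simp [PowerSeries.coeff_X_pow]
  · simp [PowerSeries.coeff_X_pow, hk, lp.single_apply]

/-- The powers of `z` span a dense subspace of `H²(β)`. -/
theorem clm_ext_monomial {E : Type*} [NormedAddCommGroup E] [NormedSpace ℂ E]
    {S T : HardySpace β →L[ℂ] E}
    (h : ∀ n : ℕ, S (ofPolynomial (Polynomial.X ^ n)) = T (ofPolynomial (Polynomial.X ^ n))) :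
    S = T := by
  ext f
  refine ((hasSum_monomial f).mapL S).unique ?_
  simpa [h] using (hasSum_monomial f).mapL T

section Reindex

variable (T : ℂ⟦X⟧ →ₗ[ℂ] ℂ⟦X⟧) {σ : ℕ → ℕ} (hσ : Function.Injective σ)
  (hT : ∀ f n, β.seq n * ‖coeff n (T f)‖ ≤ β.seq (σ n) * ‖coeff (σ n) f‖)

theorem summable_sq_reindex (T : ℂ⟦X⟧ →ₗ[ℂ] ℂ⟦X⟧) {σ : ℕ → ℕ} (hσ : Function.Injective σ)
    (hT : ∀ f n, β.seq n * ‖coeff n (T f)‖ ≤ β.seq (σ n) * ‖coeff (σ n) f‖) (f : HardySpace β) :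
    Summable fun n => (β.seq n * ‖coeff n (T f)‖) ^ 2 :=
  .of_nonneg_of_le (fun _ => sq_nonneg _)
    (fun n => pow_le_pow_left₀ (mul_nonneg (β.pos n).le (norm_nonneg _)) (hT f n) 2)
    ((summable_sq f).comp_injective hσ)

/-- A linear map on power series whose weighted coefficients are dominated by a subfamily of the
weighted coefficients of the argument, as an operator on `H²(β)`. -/
def reindexL : HardySpace β →L[ℂ] HardySpace β :=
  ((T.comp (HardySpace β).subtype).codRestrict (HardySpace β)
    fun f => mem_iff.mpr (summable_sq_reindex T hσ hT f)).mkContinuous 1 fun f => by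
      refine le_of_sq_le_sq ?_ (by positivity)
      rw [one_mul, norm_sq_eq_tsum, norm_sq_eq_tsum]
      refine le_trans (Summable.tsum_le_tsum (fun n => ?_) (summable_sq_reindex T hσ hT f)
        ((summable_sq f).comp_injective hσ))
        (tsum_comp_le_tsum_of_inj (summable_sq f) (fun _ => sq_nonneg _) hσ)
      exact pow_le_pow_left₀ (mul_nonneg (β.pos n).le (norm_nonneg _)) (hT f n) 2

theorem norm_reindexL_le : ‖reindexL T hσ hT‖ ≤ 1 :=
  LinearMap.mkContinuous_norm_le _ zero_le_one _

end Reindex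

/-! ### The chain of length three -/

/-- The linear map erasing the odd coefficients of a power series. -/
def evenPart : ℂ⟦X⟧ →ₗ[ℂ] ℂ⟦X⟧ where
  toFun f := PowerSeries.mk fun n => if Even n then coeff n f else 0
  map_add' f g := by
    ext n
    by_cases h : Even n <;> simp [h]
  map_smul' c f := by
    ext n
    by_cases h : Even n <;> simp [h]

theorem coeff_evenPart (f : ℂ⟦X⟧) (n : ℕ) :
    coeff n (evenPart f) = if Even n then coeff n f else 0 := by
  simp [evenPart]

/-- The projection of `H²(β)` onto its even elements. -/
def evenProj : HardySpace β →L[ℂ] HardySpace β :=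
  reindexL evenPart Function.injective_id fun f n => by
    rw [coeff_evenPart]
    split_ifs
    · exact le_rfl
    · simpa using mul_nonneg (β.pos n).le (norm_nonneg _)

theorem coeff_evenProj (f : HardySpace β) (n : ℕ) :
    coeff n ((evenProj f : HardySpace β) : ℂ⟦X⟧) = if Even n then coeff n (f : ℂ⟦X⟧) else 0 :=
  coeff_evenPart _ _

/-- The rank one operator `∑ aₙ zⁿ ↦ a₀`. -/
def constProj : HardySpace β →L[ℂ] HardySpace β :=
  (coeffL 0).smulRight (ofPolynomial 1)

theorem isCompactOperator_constProj :
    IsCompactOperator (constProj : HardySpace β →L[ℂ] HardySpace β) :=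
  ((isCompactOperator_id (E := ℂ)).clm_comp
    (ContinuousLinearMap.toSpanSingleton ℂ (ofPolynomial 1 : HardySpace β))).comp_clm (coeffL 0)

theorem coe_constProj (f : HardySpace β) :
    ((constProj f : HardySpace β) : ℂ⟦X⟧) = PowerSeries.C (coeff 0 (f : ℂ⟦X⟧)) := by
  simp [constProj, PowerSeries.smul_eq_C_mul]

theorem constProj_ne_zero : (constProj : HardySpace β →L[ℂ] HardySpace β) ≠ 0 := by
  intro h
  have h1 := congrArg (fun T => coeff 0 ((T (ofPolynomial 1) : HardySpace β) : ℂ⟦X⟧)) h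
  simp [coe_constProj] at h1

end HardySpace

section Chain

variable {β : HardyWeight} {Mz : HardySpace β →L[ℂ] HardySpace β}

open HardySpace

theorem IsMulByZ.isNonScalar_pow (hM : IsMulByZ Mz) {k : ℕ} (hk : k ≠ 0) :
    IsNonScalar (Mz ^ k) := by
  intro c h
  have hpow : ∀ (m : ℕ) (f : HardySpace β),
      (((Mz ^ m) f : HardySpace β) : ℂ⟦X⟧) = PowerSeries.X ^ m * (f : ℂ⟦X⟧) := by
    intro m f
    induction m with
    | zero => simp
    | succ m ih => rw [pow_succ', mul_apply_eq_comp, hM, ih, pow_succ', mul_assoc]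
  have h1 := hpow k (ofPolynomial 1)
  rw [h] at h1
  have h2 := congrArg (coeff k) h1
  simp [PowerSeries.coeff_one, hk, PowerSeries.coeff_X_pow] at h2

theorem isNonScalar_evenProj :
    IsNonScalar (evenProj : HardySpace β →L[ℂ] HardySpace β) := by
  intro c h
  have h0 := congrArg (fun T => coeff 0 ((T (ofPolynomial 1) : HardySpace β) : ℂ⟦X⟧)) h
  have h1 := congrArg
    (fun T => coeff 1 ((T (ofPolynomial Polynomial.X) : HardySpace β) : ℂ⟦X⟧)) h
  simp [coeff_evenProj] at h0 h1
  exact one_ne_zero (h0.trans h1.symm)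

theorem IsMulByZ.commute_sq_evenProj (hM : IsMulByZ Mz) : Commute (Mz ^ 2) evenProj := by
  ext f : 1
  apply Subtype.ext
  ext n
  rw [pow_two, mul_apply_eq_comp, mul_apply_eq_comp,
    mul_apply_eq_comp, coeff_evenProj, mul_apply_eq_comp, hM, hM, hM, hM]
  rcases n with _ | _ | n
  · simp
  · simp [PowerSeries.coeff_succ_X_mul]
  · rw [PowerSeries.coeff_succ_X_mul, PowerSeries.coeff_succ_X_mul, PowerSeries.coeff_succ_X_mul,
      PowerSeries.coeff_succ_X_mul, coeff_evenProj]
    simp [Nat.even_add_one, parity_simps]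

theorem commute_evenProj_constProj :
    Commute (evenProj : HardySpace β →L[ℂ] HardySpace β) constProj := by
  ext f : 1
  apply Subtype.ext
  ext n
  rw [mul_apply_eq_comp, mul_apply_eq_comp, coeff_evenProj,
    coe_constProj, coe_constProj, coeff_evenProj]
  rcases n with _ | n <;> simp

/-- The chain `M_z ↔ M_z² ↔ P ↔ K`, with `P` the projection onto the even power series and `K` the
projection onto the constants. -/
theorem IsMulByZ.isOfChain_three (hM : IsMulByZ Mz) : IsOfChain Mz 3 := by
  refine ⟨![Mz ^ 2, evenProj], constProj, ?_, constProj_ne_zero, isCompactOperator_constProj,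
    ?_, ?_, ?_⟩
  · intro i
    fin_cases i
    · exact hM.isNonScalar_pow two_ne_zero
    · exact isNonScalar_evenProj
  · exact (Commute.refl Mz).pow_right 2
  · intro i
    fin_cases i
    exact hM.commute_sq_evenProj
  · exact commute_evenProj_constProj

/-- Chains of length `0` and `1` give a chain of length `2` by repeating the non-scalar
operator `M_z`, and chains of length `2` are what the Lomonosov property asks for. -/
theorem IsMulByZ.isOfMinimalChain_three (hM : IsMulByZ Mz) (hL : ¬ IsLomonosov Mz) :
    IsOfMinimalChain Mz 3 := by
  have hns : IsNonScalar Mz := by simpa using hM.isNonScalar_pow one_ne_zero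
  refine ⟨hM.isOfChain_three, fun k hk hc => hL ?_⟩
  interval_cases k
  · refine ⟨Mz, Mz, hns, fun h => hns 0 (by simpa using h), hc, .refl _, .refl _⟩
  · obtain ⟨K, hK, hKc, hcomm⟩ := hc
    exact ⟨Mz, K, hns, hK, hKc, .refl _, hcomm⟩
  · obtain ⟨S, K, hS, hK, hKc, hTS, -, hSK⟩ := hc
    exact ⟨S 0, K, hS 0, hK, hKc, hTS, hSK⟩

end Chain

/-! ### Regular weights -/

/-- Conditions on `β` under which `H²(β)` is a Banach algebra, up to an equivalent norm, of
functions on the closed unit disc, of class `C¹` up to the boundary and with the closed disc as its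
character space. -/
structure HardyWeight.IsRegular (β : HardyWeight) : Prop where
  /-- the backward shift is a contraction -/
  mono : Monotone β.seq
  /-- by the Cauchy–Schwarz inequality, multiplication is bounded -/
  convolution : ∃ C : ℝ, ∀ N, ∑ p ∈ antidiagonal N,
    (β.seq N / (β.seq p.1 * β.seq p.2)) ^ 2 ≤ C
  /-- the derivatives of the elements extend continuously to the closed disc -/
  summable_mul : Summable fun n : ℕ => n * (β.seq n)⁻¹
  /-- the spectral radius of `M_z` is at most `1` -/
  growth : ∀ r : ℝ, 1 < r → Tendsto (fun n => β.seq n / r ^ n) atTop (𝓝 0)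

theorem summable_of_summable_natCast_mul {u : ℕ → ℝ} (hu : ∀ n, 0 ≤ u n)
    (h : Summable fun n : ℕ => n * u n) : Summable u := by
  refine (summable_nat_add_iff 1).mp ?_
  exact .of_nonneg_of_le (fun n => hu _) (fun n => le_mul_of_one_le_left (hu _) (by simp))
    ((summable_nat_add_iff 1).mpr h)

theorem HardyWeight.IsRegular.summable_inv {β : HardyWeight} (hβ : β.IsRegular) :
    Summable fun n : ℕ => (β.seq n)⁻¹ :=
  summable_of_summable_natCast_mul (fun n => inv_nonneg.mpr (β.pos n).le) hβ.summable_mul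

namespace HardySpace

variable {β : HardyWeight}

/-! ### Multiplication operators -/

theorem sq_coeff_mul_le {C : ℝ} (hC : ∀ N, ∑ p ∈ antidiagonal N,
    (β.seq N / (β.seq p.1 * β.seq p.2)) ^ 2 ≤ C) (f g : ℂ⟦X⟧) (N : ℕ) :
    (β.seq N * ‖coeff N (f * g)‖) ^ 2 ≤ C * ∑ p ∈ antidiagonal N,
      (β.seq p.1 * ‖coeff p.1 f‖) ^ 2 * (β.seq p.2 * ‖coeff p.2 g‖) ^ 2 := by
  have h1 : β.seq N * ‖coeff N (f * g)‖ ≤ ∑ p ∈ antidiagonal N,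
      (β.seq N / (β.seq p.1 * β.seq p.2)) *
        ((β.seq p.1 * ‖coeff p.1 f‖) * (β.seq p.2 * ‖coeff p.2 g‖)) := by
    rw [PowerSeries.coeff_mul]
    refine (mul_le_mul_of_nonneg_left (norm_sum_le _ _) (β.pos N).le).trans_eq ?_
    rw [mul_sum]
    refine sum_congr rfl fun p _ => ?_
    have := (β.pos p.1).ne'
    have := (β.pos p.2).ne'
    rw [norm_mul]
    field_simp
  refine (pow_le_pow_left₀ (mul_nonneg (β.pos N).le (norm_nonneg _)) h1 2).trans ?_
  refine (sum_mul_sq_le_sq_mul_sq _ _ _).trans ?_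
  simp_rw [mul_pow _ _ 2, ← mul_pow]
  exact mul_le_mul_of_nonneg_right (hC N) (sum_nonneg fun _ _ => by positivity)

theorem summable_antidiagonal (f g : HardySpace β) :
    Summable fun N => ∑ p ∈ antidiagonal N,
      (β.seq p.1 * ‖coeff p.1 (f : ℂ⟦X⟧)‖) ^ 2 * (β.seq p.2 * ‖coeff p.2 (g : ℂ⟦X⟧)‖) ^ 2 :=
  (summable_norm_sum_mul_antidiagonal_of_summable_norm (summable_sq f).norm
    (summable_sq g).norm).of_norm

theorem tsum_antidiagonal (f g : HardySpace β) :
    ∑' N, ∑ p ∈ antidiagonal N, (β.seq p.1 * ‖coeff p.1 (f : ℂ⟦X⟧)‖) ^ 2 *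
      (β.seq p.2 * ‖coeff p.2 (g : ℂ⟦X⟧)‖) ^ 2 = (‖f‖ * ‖g‖) ^ 2 := by
  rw [mul_pow, norm_sq_eq_tsum f, norm_sq_eq_tsum g,
    tsum_mul_tsum_eq_tsum_sum_antidiagonal_of_summable_norm (summable_sq f).norm
      (summable_sq g).norm]

theorem mul_mem (hβ : β.IsRegular) (f g : HardySpace β) :
    (f : ℂ⟦X⟧) * g ∈ HardySpace β := by
  obtain ⟨C, hC⟩ := hβ.convolution
  exact mem_iff.mpr <| .of_nonneg_of_le (fun _ => sq_nonneg _)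
    (sq_coeff_mul_le hC f g) ((summable_antidiagonal f g).mul_left C)

/-- Multiplication `(φ, f) ↦ φ f` of `H²(β)` for a regular weight, as a bounded bilinear map. -/
def mulL (hβ : β.IsRegular) : HardySpace β →L[ℂ] HardySpace β →L[ℂ] HardySpace β :=
  LinearMap.mkContinuous₂
    (LinearMap.mk₂ ℂ (fun f g : HardySpace β => (⟨(f : ℂ⟦X⟧) * g, mul_mem hβ f g⟩ : HardySpace β))
      (fun _ _ _ => Subtype.ext (add_mul _ _ _)) (fun _ _ _ => Subtype.ext (smul_mul_assoc _ _ _))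
      (fun _ _ _ => Subtype.ext (mul_add _ _ _)) (fun _ _ _ => Subtype.ext (mul_smul_comm _ _ _)))
    (√hβ.convolution.choose) fun f g => by
      have hC := hβ.convolution.choose_spec
      have hC0 : 0 ≤ hβ.convolution.choose := (sum_nonneg fun _ _ => sq_nonneg _).trans (hC 0)
      refine le_of_sq_le_sq ?_ (by positivity)
      rw [norm_sq_eq_tsum, mul_assoc, mul_pow, Real.sq_sqrt hC0, ← tsum_antidiagonal f g,
        ← tsum_mul_left]
      exact Summable.tsum_le_tsum (sq_coeff_mul_le hC f g)
        (summable_sq (⟨(f : ℂ⟦X⟧) * g, mul_mem hβ f g⟩ : HardySpace β))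
        ((summable_antidiagonal f g).mul_left _)

@[simp]
theorem coe_mulL (hβ : β.IsRegular) (f g : HardySpace β) :
    ((mulL hβ f g : HardySpace β) : ℂ⟦X⟧) = (f : ℂ⟦X⟧) * g := rfl

theorem isMulByZ_mulL (hβ : β.IsRegular) : IsMulByZ (mulL hβ (ofPolynomial Polynomial.X)) :=
  fun f => by simp

theorem mulL_ofPolynomial_pow (hβ : β.IsRegular) (n : ℕ) :
    mulL hβ (ofPolynomial (Polynomial.X ^ n)) = mulL hβ (ofPolynomial Polynomial.X) ^ n := by
  induction n with
  | zero =>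
    ext f : 1
    apply Subtype.ext
    simp
  | succ n ih =>
    rw [pow_succ' (mulL hβ _), ← ih]
    ext f : 1
    apply Subtype.ext
    simp [mul_apply_eq_comp, pow_succ', mul_assoc]

/-- Every operator commuting with `M_z` is the multiplication by its value at `1`. -/
theorem eq_mulL_of_commute (hβ : β.IsRegular) {Mz S : HardySpace β →L[ℂ] HardySpace β}
    (hM : IsMulByZ Mz) (hS : Commute Mz S) : S = mulL hβ (S (ofPolynomial 1)) := by
  refine clm_ext_monomial fun n => ?_
  induction n with
  | zero =>
    apply Subtype.ext
    simp
  | succ n ih =>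
    have h : (ofPolynomial (Polynomial.X ^ (n + 1)) : HardySpace β) =
        Mz (ofPolynomial (Polynomial.X ^ n)) := Subtype.ext (by simp [hM _, pow_succ'])
    have h1 : S (Mz (ofPolynomial (Polynomial.X ^ n))) =
        Mz (S (ofPolynomial (Polynomial.X ^ n))) := DFunLike.congr_fun hS.symm.eq _
    rw [h, h1, ih]
    apply Subtype.ext
    simp only [coe_mulL, hM _]
    ring

/-! ### Point evaluations on the closed disc -/

/-- The value `∑ aₙ wⁿ` of a power series, with the junk value `0` if the series diverges. -/
def value (f : ℂ⟦X⟧) (w : ℂ) : ℂ := ∑' n, coeff n f * w ^ n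

theorem norm_coeff_mul_pow_le (f : HardySpace β) {w : ℂ} (hw : ‖w‖ ≤ 1) (n : ℕ) :
    ‖coeff n (f : ℂ⟦X⟧) * w ^ n‖ ≤ (β.seq n)⁻¹ * ‖f‖ := by
  rw [norm_mul, norm_pow]
  exact (mul_le_of_le_one_right (norm_nonneg _) (pow_le_one₀ (norm_nonneg _) hw)).trans
    (norm_coeff_le f n)

theorem summable_norm_value (hβ : β.IsRegular) (f : HardySpace β) {w : ℂ} (hw : ‖w‖ ≤ 1) :
    Summable fun n => ‖coeff n (f : ℂ⟦X⟧) * w ^ n‖ :=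
  .of_nonneg_of_le (fun _ => norm_nonneg _) (norm_coeff_mul_pow_le f hw)
    (hβ.summable_inv.mul_right _)

theorem hasSum_value (hβ : β.IsRegular) (f : HardySpace β) {w : ℂ} (hw : ‖w‖ ≤ 1) :
    HasSum (fun n => coeff n (f : ℂ⟦X⟧) * w ^ n) (value f w) :=
  (summable_norm_value hβ f hw).of_norm.hasSum

/-- The point evaluation at `w`, where `‖w‖ ≤ 1`. -/
def evalL (hβ : β.IsRegular) {w : ℂ} (hw : ‖w‖ ≤ 1) : HardySpace β →L[ℂ] ℂ :=
  LinearMap.mkContinuous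
    { toFun := fun f => value f w
      map_add' := fun f g => by
        refine (hasSum_value hβ (f + g) hw).unique ?_
        simpa [add_mul] using (hasSum_value hβ f hw).add (hasSum_value hβ g hw)
      map_smul' := fun c f => by
        refine (hasSum_value hβ (c • f) hw).unique ?_
        simpa [mul_assoc] using (hasSum_value hβ f hw).mul_left c }
    (∑' n, (β.seq n)⁻¹) fun f => by
      rw [← tsum_mul_right]
      exact tsum_of_norm_bounded (hβ.summable_inv.mul_right _).hasSum (norm_coeff_mul_pow_le f hw)

@[simp]
theorem evalL_apply (hβ : β.IsRegular) {w : ℂ} (hw : ‖w‖ ≤ 1) (f : HardySpace β) :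
    evalL hβ hw f = value f w := rfl

@[simp]
theorem value_polynomial (p : Polynomial ℂ) (w : ℂ) : value (p : ℂ⟦X⟧) w = p.eval w := by
  rw [value, tsum_eq_sum (s := p.support) fun n hn => by
    simp [Polynomial.notMem_support_iff.mp hn], Polynomial.eval_eq_sum, Polynomial.sum]
  simp

theorem value_mul (hβ : β.IsRegular) (f g : HardySpace β) {w : ℂ} (hw : ‖w‖ ≤ 1) :
    value ((f : ℂ⟦X⟧) * g) w = value f w * value g w := by
  rw [value, value, value, tsum_mul_tsum_eq_tsum_sum_antidiagonal_of_summable_norm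
    (summable_norm_value hβ f hw) (summable_norm_value hβ g hw)]
  refine tsum_congr fun n => ?_
  rw [PowerSeries.coeff_mul, sum_mul]
  refine sum_congr rfl fun p hp => ?_
  rw [← mem_antidiagonal.mp hp, pow_add]
  ring

theorem analyticOnNhd_value (hβ : β.IsRegular) (f : HardySpace β) :
    AnalyticOnNhd ℂ (value f) (Metric.ball 0 1) := by
  refine DifferentiableOn.analyticOnNhd ?_ Metric.isOpen_ball
  refine Complex.differentiableOn_tsum_of_summable_norm (hβ.summable_inv.mul_right ‖f‖)
    (fun n => by fun_prop) Metric.isOpen_ball fun n w hw => ?_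
  exact norm_coeff_mul_pow_le f (mem_ball_zero_iff.mp hw).le n

theorem eq_zero_of_value_eq_zero (hβ : β.IsRegular) (f : HardySpace β)
    (h : ∀ w ∈ Metric.ball (0 : ℂ) 1, value f w = 0) : f = 0 := by
  have h1 : HasFPowerSeriesAt (0 : ℂ → ℂ)
      (FormalMultilinearSeries.ofScalars ℂ fun n => coeff n (f : ℂ⟦X⟧)) 0 := by
    rw [hasFPowerSeriesAt_iff]
    filter_upwards [Metric.ball_mem_nhds (0 : ℂ) one_pos] with w hw
    have h2 := hasSum_value hβ f (mem_ball_zero_iff.mp hw).le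
    rw [h w hw] at h2
    simpa [FormalMultilinearSeries.coeff_ofScalars, mul_comm] using h2
  apply Subtype.ext
  ext n
  have h2 := congrArg (fun p => FormalMultilinearSeries.coeff p n) h1.eq_zero
  rw [FormalMultilinearSeries.coeff_ofScalars] at h2
  exact h2

theorem norm_pow_sub_pow_le_of_norm_le_one {v w : ℂ} (hv : ‖v‖ ≤ 1) (hw : ‖w‖ ≤ 1) (n : ℕ) :
    ‖v ^ n - w ^ n‖ ≤ n * ‖v - w‖ := by
  induction n with
  | zero => simp
  | succ n ih =>
    have e : v ^ (n + 1) - w ^ (n + 1) = v * (v ^ n - w ^ n) + (v - w) * w ^ n := by ring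
    rw [e]
    refine (norm_add_le _ _).trans ?_
    rw [norm_mul, norm_mul, norm_pow]
    have h1 := mul_le_of_le_one_left (norm_nonneg (v ^ n - w ^ n)) hv
    have h2 := mul_le_of_le_one_right (norm_nonneg (v - w)) (pow_le_one₀ (norm_nonneg w) hw (n := n))
    push_cast
    linarith

theorem exists_lipschitzOnWith_value (hβ : β.IsRegular) (f : HardySpace β) :
    ∃ L, LipschitzOnWith L (value f) (Metric.closedBall 0 1) := by
  refine ⟨Real.toNNReal (∑' n : ℕ, n * (β.seq n)⁻¹ * ‖f‖), LipschitzOnWith.of_dist_le_mul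
    fun v hv w hw => ?_⟩
  rw [mem_closedBall_zero_iff] at hv hw
  rw [Real.coe_toNNReal _ (tsum_nonneg fun n => mul_nonneg (mul_nonneg n.cast_nonneg
    (inv_nonneg.mpr (β.pos n).le)) (norm_nonneg f)), dist_eq_norm, dist_eq_norm, ← tsum_mul_right,
    ← ((hasSum_value hβ f hv).sub (hasSum_value hβ f hw)).tsum_eq]
  refine tsum_of_norm_bounded
    ((hβ.summable_mul.mul_right ‖f‖).mul_right ‖v - w‖).hasSum fun n => ?_
  rw [← mul_sub, norm_mul]
  calc _ ≤ ((β.seq n)⁻¹ * ‖f‖) * (n * ‖v - w‖) :=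
        mul_le_mul (norm_coeff_le f n) (norm_pow_sub_pow_le_of_norm_le_one hv hw n)
          (norm_nonneg _) (mul_nonneg (inv_nonneg.mpr (β.pos n).le) (norm_nonneg f))
    _ = _ := by ring

/-- The boundary values of an element of `H²(β)` form a Lipschitz curve. -/
theorem dimH_value_image_sphere_le (hβ : β.IsRegular) (f : HardySpace β) :
    dimH (value f '' Metric.sphere 0 1) ≤ 1 := by
  obtain ⟨L, hL⟩ := exists_lipschitzOnWith_value hβ f
  refine ((hL.mono Metric.sphere_subset_closedBall).dimH_image_le).trans ?_
  have h := (lipschitzWith_circleMap 0 1).dimH_range_le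
  rwa [range_circleMap, abs_one, Real.dimH_univ] at h

end HardySpace

/-! ### Compact operators and commuting operators -/

section CompactOperator

variable {X : Type*} [NormedAddCommGroup X] [NormedSpace ℂ X]

/-- The eigenspaces of a compact operator for non-zero eigenvalues are finite-dimensional and
invariant under the commutant. -/
theorem exists_hasEigenvalue_of_commute {K S : X →L[ℂ] X} (hK : IsCompactOperator K)
    (hSK : Commute S K) {μ : ℂ} (hμ : μ ≠ 0)
    (h : Module.End.HasEigenvalue (K : Module.End ℂ X) μ) :
    ∃ c, Module.End.HasEigenvalue (S : Module.End ℂ X) c := by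
  let V : Submodule ℂ X := Module.End.eigenspace (K : Module.End ℂ X) μ
  have hV : ∀ x, x ∈ V ↔ K x = μ • x := fun x => Module.End.mem_eigenspace_iff
  have hclosed : IsClosed (V : Set X) := by
    have e : (V : Set X) = {x | K x = μ • x} := Set.ext hV
    rw [e]
    exact isClosed_eq K.continuous (continuous_const_smul μ)
  have hinv : ∀ x ∈ V, (K : X →ₗ[ℂ] X) x ∈ V := fun x hx => by
    have : (K : X →ₗ[ℂ] X) x = μ • x := (hV x).mp hx
    rw [this]
    exact V.smul_mem μ hx
  have hcomp : IsCompactOperator (_root_.id : V → V) := by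
    have h1 := (IsCompactOperator.restrict (f := (K : X →ₗ[ℂ] X)) hK hinv hclosed).smul μ⁻¹
    have e : (_root_.id : V → V) = μ⁻¹ • ⇑((K : X →ₗ[ℂ] X).restrict hinv) := by
      funext x
      apply Subtype.ext
      have : K (x : X) = μ • (x : X) := (hV x).mp x.2
      simp [this, hμ]
    rw [e]
    exact h1
  have : FiniteDimensional ℂ V := .of_isCompactOperator_id hcomp
  have : Nontrivial V := (Submodule.nontrivial_iff_ne_bot).mpr h
  have hS : ∀ x ∈ V, (S : Module.End ℂ X) x ∈ V := fun x hx => by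
    rw [hV] at hx ⊢
    have h1 : K (S x) = S (K x) := DFunLike.congr_fun hSK.symm.eq x
    change K (S x) = μ • S x
    rw [h1, hx, map_smul]
  obtain ⟨c, hc⟩ := Module.End.exists_eigenvalue ((S : Module.End ℂ X).restrict hS)
  obtain ⟨v, hv⟩ := hc.exists_hasEigenvector
  refine ⟨c, Module.End.hasEigenvalue_of_hasEigenvector (x := (v : X))
    ⟨Module.End.mem_eigenspace_iff.mpr ?_, fun h0 => hv.2 (Subtype.ext h0)⟩⟩
  exact congrArg Subtype.val hv.apply_eq_smul

/-- An eigenvalue of the adjoint of a compact operator is an eigenvalue of the operator. -/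
theorem hasEigenvalue_of_functional {K : X →L[ℂ] X} [CompleteSpace X] (hK : IsCompactOperator K)
    {ε : X →L[ℂ] ℂ} (hε : ε ≠ 0) {μ : ℂ} (hμ : μ ≠ 0) (h : ∀ x, ε (K x) = μ * ε x) :
    Module.End.HasEigenvalue (K : Module.End ℂ X) μ := by
  refine (hK.hasEigenvalue_or_mem_resolventSet hμ).resolve_right fun hr => hε ?_
  rw [spectrum.mem_resolventSet_iff, ContinuousLinearMap.isUnit_iff_bijective] at hr
  ext y
  obtain ⟨x, rfl⟩ := hr.2 y
  simp [h, Algebra.algebraMap_eq_smul_one]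

end CompactOperator

/-! ### Zeros of holomorphic functions -/

theorem AnalyticOnNhd.countable_zeros {U : Set ℂ} {g : ℂ → ℂ} (hg : AnalyticOnNhd ℂ g U)
    (hU : IsPreconnected U) (h0 : ∃ x ∈ U, g x ≠ 0) : {w ∈ U | g w = 0}.Countable := by
  obtain ⟨x, hx, hgx⟩ := h0
  have h := hg.preimage_zero_mem_codiscreteWithin hgx hx ⟨⟨x, hx⟩, hU⟩
  have e : {w ∈ U | g w = 0} = (g ⁻¹' {0}ᶜ)ᶜ ∩ U := by
    ext w
    simp [and_comm]
  rw [e]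
  refine (HereditarilyLindelofSpace.isLindelof _).countable_of_isDiscrete
    (isDiscrete_of_codiscreteWithin ?_)
  rwa [compl_compl]

/-! ### Characters of singly generated Banach algebras -/

/-- Gelfand theory for the closed algebra generated by one element of a Banach algebra. -/
theorem Algebra.elemental.isUnit_of_forall_character {B : Type*} [NormedRing B]
    [NormedAlgebra ℂ B] [CompleteSpace B] (x : B) (a : Algebra.elemental ℂ x)
    (h : ∀ χ : Algebra.elemental ℂ x →ₐ[ℂ] ℂ, Continuous χ → χ a ≠ 0) : IsUnit a := by
  let : NormedCommRing (Algebra.elemental ℂ x) :=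
    { Subalgebra.normedRing (Algebra.elemental ℂ x) with mul_comm := mul_comm }
  by_contra ha
  obtain ⟨χ, hχ⟩ := WeakDual.CharacterSpace.exists_apply_eq_zero ha
  exact h (WeakDual.CharacterSpace.toAlgHom χ) (map_continuous χ) hχ

namespace HardySpace

variable {β : HardyWeight}

/-! ### Division and invertibility in `H²(β)` -/

/-- The linear map `f ↦ (f - f(0)) / z` on power series. -/
def divX : ℂ⟦X⟧ →ₗ[ℂ] ℂ⟦X⟧ where
  toFun f := PowerSeries.mk fun n => coeff (n + 1) f
  map_add' f g := by
    ext n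
    simp
  map_smul' c f := by
    ext n
    simp

theorem coeff_divX (f : ℂ⟦X⟧) (n : ℕ) : coeff n (divX f) = coeff (n + 1) f := by
  simp [divX]

theorem X_mul_divX (f : ℂ⟦X⟧) :
    PowerSeries.X * divX f = f - PowerSeries.C (coeff 0 f) := by
  ext n
  rcases n with _ | n
  · simp
  · simp [PowerSeries.coeff_succ_X_mul, coeff_divX]

/-- With `B` the backward shift, `g = (1 - w B)⁻¹ B f` satisfies `(z - w) g = f - f(w)`. -/
theorem exists_eq_X_sub_C_mul (hβ : β.IsRegular) (f : HardySpace β) {w : ℂ} (hw : ‖w‖ < 1)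
    (hf : value f w = 0) :
    ∃ g : HardySpace β, (f : ℂ⟦X⟧) = (PowerSeries.X - PowerSeries.C w) * (g : ℂ⟦X⟧) := by
  have hT : ∀ (f : ℂ⟦X⟧) (n : ℕ), β.seq n * ‖coeff n (divX f)‖ ≤
      β.seq (n + 1) * ‖coeff (n + 1) f‖ := fun f n => by
    rw [coeff_divX]
    exact mul_le_mul_of_nonneg_right (hβ.mono n.le_succ) (norm_nonneg _)
  let B : HardySpace β →L[ℂ] HardySpace β := reindexL divX Nat.succ_injective hT
  have hB : ‖w • B‖ < 1 := by
    rw [norm_smul]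
    exact (mul_le_of_le_one_right (norm_nonneg w) (norm_reindexL_le ..)).trans_lt hw
  obtain ⟨g, hg⟩ := (ContinuousLinearMap.isUnit_iff_bijective.mp
    (isUnit_one_sub_of_norm_lt_one hB)).2 (B f)
  refine ⟨g, ?_⟩
  have h1 : (g : ℂ⟦X⟧) = divX ((w • g + f : HardySpace β) : ℂ⟦X⟧) := by
    have h2 : g = B (w • g + f) := by
      rw [map_add, ← hg]
      simp
    exact congrArg Subtype.val h2
  have h2 := X_mul_divX ((w • g + f : HardySpace β) : ℂ⟦X⟧)
  rw [← h1] at h2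
  set a := coeff 0 ((w • g + f : HardySpace β) : ℂ⟦X⟧)
  have h3 : (f : ℂ⟦X⟧) =
      (PowerSeries.X - PowerSeries.C w) * (g : ℂ⟦X⟧) + PowerSeries.C a := by
    have h4 : ((w • g + f : HardySpace β) : ℂ⟦X⟧) = PowerSeries.C w * (g : ℂ⟦X⟧) + f := by
      simp [PowerSeries.smul_eq_C_mul]
    rw [h4] at h2
    linear_combination -h2
  have h5 : f = mulL hβ (ofPolynomial (Polynomial.X - Polynomial.C w)) g +
      ofPolynomial (Polynomial.C a) := Subtype.ext (by simpa using h3)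
  have h6 := congrArg (evalL hβ hw.le) h5
  rw [map_add, evalL_apply, evalL_apply, evalL_apply, hf, coe_mulL, value_mul hβ _ _ hw.le] at h6
  simp only [coe_ofPolynomial, value_polynomial] at h6
  have ha : a = 0 := by simpa using h6.symm
  rw [h3, ha]
  simp

theorem exists_eq_prod_mul (hβ : β.IsRegular) (f : HardySpace β) (W : Finset ℂ)
    (hW : ∀ w ∈ W, ‖w‖ < 1) (hf : ∀ w ∈ W, value f w = 0) :
    ∃ g : HardySpace β, f =
      mulL hβ (ofPolynomial (∏ w ∈ W, (Polynomial.X - Polynomial.C w))) g := by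
  induction W using Finset.induction_on with
  | empty => exact ⟨f, Subtype.ext (by simp)⟩
  | insert v W hv ih =>
    obtain ⟨g, hg⟩ := ih (fun w hw => hW w (mem_insert_of_mem hw))
      (fun w hw => hf w (mem_insert_of_mem hw))
    have hv1 := hW v (mem_insert_self v W)
    have hgv : value g v = 0 := by
      have h1 := hf v (mem_insert_self v W)
      rw [hg, coe_mulL, value_mul hβ _ _ hv1.le, coe_ofPolynomial, value_polynomial] at h1
      refine (mul_eq_zero.mp h1).resolve_left ?_
      rw [Polynomial.eval_prod]
      refine prod_ne_zero_iff.mpr fun w hw => ?_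
      simpa [sub_eq_zero] using fun h : v = w => hv (h ▸ hw)
    obtain ⟨k, hk⟩ := exists_eq_X_sub_C_mul hβ g hv1 hgv
    refine ⟨k, Subtype.ext ?_⟩
    rw [hg, coe_mulL, coe_mulL, hk, prod_insert hv]
    simp
    ring

theorem mulL_mem_elemental (hβ : β.IsRegular) (f : HardySpace β) :
    mulL hβ f ∈ Algebra.elemental ℂ (mulL hβ (ofPolynomial Polynomial.X)) := by
  refine (Algebra.elemental.isClosed ℂ _).mem_of_tendsto
    ((hasSum_monomial f).mapL (mulL hβ)) (Eventually.of_forall fun s => ?_)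
  refine Subalgebra.sum_mem _ fun n _ => ?_
  rw [map_smul, mulL_ofPolynomial_pow]
  exact Subalgebra.smul_mem _ (Subalgebra.pow_mem _ (Algebra.elemental.self_mem ℂ _) n) _

theorem norm_ofPolynomial_X_pow (n : ℕ) :
    ‖(ofPolynomial (Polynomial.X ^ n) : HardySpace β)‖ = β.seq n := by
  rw [← sq_eq_sq₀ (norm_nonneg _) (β.pos n).le, norm_sq_eq_tsum, tsum_eq_single n]
  · simp [PowerSeries.coeff_X_pow]
  · intro k hk
    simp [PowerSeries.coeff_X_pow, hk]

/-- A function in `H²(β)` without zeros in the closed disc is invertible: in the closed algebra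
generated by `M_z`, every character is a point evaluation in the closed disc. -/
theorem isUnit_mulL (hβ : β.IsRegular) (u : HardySpace β)
    (hu : ∀ w : ℂ, ‖w‖ ≤ 1 → value u w ≠ 0) : IsUnit (mulL hβ u) := by
  set Z := mulL hβ (ofPolynomial Polynomial.X) with hZ
  let A := Algebra.elemental ℂ Z
  let a : A := ⟨mulL hβ u, mulL_mem_elemental hβ u⟩
  suffices IsUnit a from this.map A.val
  refine Algebra.elemental.isUnit_of_forall_character Z a fun χ hχc hχ => ?_
  let z : A := ⟨Z, Algebra.elemental.self_mem ℂ Z⟩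
  let m : HardySpace β →L[ℂ] A :=
    (mulL hβ).codRestrict (Subalgebra.toSubmodule A) (mulL_mem_elemental hβ)
  have hm : ∀ n, m (ofPolynomial (Polynomial.X ^ n)) = z ^ n := fun n =>
    Subtype.ext (mulL_ofPolynomial_pow hβ n)
  let χL : HardySpace β →L[ℂ] ℂ := (ContinuousLinearMap.mk χ.toLinearMap hχc).comp m
  have hχL : ∀ n, χL (ofPolynomial (Polynomial.X ^ n)) = χ z ^ n := fun n => by
    change χ (m _) = _
    rw [hm, map_pow]
  have hz : ‖χ z‖ ≤ 1 := by
    by_contra! hz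
    -- `‖χ z‖ⁿ = ‖χ (zⁿ)‖` is at most a constant times `βₙ`, hence `‖χ z‖ ≤ 1` by subexponential
    -- growth.
    have h1 := (hβ.growth _ hz).const_mul ‖χL‖
    rw [mul_zero] at h1
    have h2 : ∀ n, 1 ≤ ‖χL‖ * (β.seq n / ‖χ z‖ ^ n) := fun n => by
      rw [← mul_div_assoc, one_le_div (by positivity), ← norm_pow, ← hχL,
        ← norm_ofPolynomial_X_pow n]
      exact χL.le_opNorm _
    exact absurd (ge_of_tendsto' h1 h2) (by norm_num)
  have he : χL = evalL hβ hz := clm_ext_monomial fun n => by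
    rw [hχL, evalL_apply, coe_ofPolynomial, value_polynomial]
    simp
  refine hu _ hz ?_
  rw [← evalL_apply hβ hz, ← he]
  exact hχ

/-! ### Fibres of elements of `H²(β)` -/

theorem isPreconnected_disc : IsPreconnected (Metric.ball (0 : ℂ) 1) :=
  (convex_ball _ _).isPreconnected

/-- The image of the open disc is open, hence not covered by the curve of boundary values
together with countably many points. -/
theorem exists_generic_fibre (hβ : β.IsRegular) (φ h : HardySpace β)
    (hφ : ¬ ∃ c, ∀ w ∈ Metric.ball (0 : ℂ) 1, value φ w = c) (hh : h ≠ 0) :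
    ∃ z ∈ Metric.ball (0 : ℂ) 1, value φ z ∉ value φ '' Metric.sphere 0 1 ∧
      ∀ w ∈ Metric.ball (0 : ℂ) 1, value φ w = value φ z →
        deriv (value φ) w ≠ 0 ∧ value h w ≠ 0 := by
  have hφa := analyticOnNhd_value hβ φ
  have hopen : IsOpen (value φ '' Metric.ball 0 1) :=
    (hφa.is_constant_or_isOpen isPreconnected_disc).resolve_left hφ _ subset_rfl
      Metric.isOpen_ball
  have hd : ∃ x ∈ Metric.ball (0 : ℂ) 1, deriv (value φ) x ≠ 0 := by
    by_contra! hd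
    exact hφ ((Metric.isOpen_ball (x := (0 : ℂ)) (ε := 1)).exists_is_const_of_deriv_eq_zero
      isPreconnected_disc hφa.differentiableOn hd)
  have hv : ∃ x ∈ Metric.ball (0 : ℂ) 1, value h x ≠ 0 := by
    by_contra! hv
    exact hh (eq_zero_of_value_eq_zero hβ h hv)
  let N : Set ℂ := {w ∈ Metric.ball (0 : ℂ) 1 | deriv (value φ) w = 0} ∪
    {w ∈ Metric.ball (0 : ℂ) 1 | value h w = 0}
  have hN : N.Countable := (hφa.deriv.countable_zeros isPreconnected_disc hd).union
    ((analyticOnNhd_value hβ h).countable_zeros isPreconnected_disc hv)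
  have hdim : dimH (value φ '' Metric.sphere 0 1 ∪ value φ '' N) < Module.finrank ℝ ℂ := by
    rw [dimH_union, dimH_countable (hN.image _), Complex.finrank_real_complex]
    exact (max_le (dimH_value_image_sphere_le hβ φ) zero_le_one).trans_lt (by norm_num)
  obtain ⟨_, ⟨z, hz, rfl⟩, hc⟩ := (dense_compl_of_dimH_lt_finrank hdim).inter_open_nonempty _
    hopen ⟨_, Set.mem_image_of_mem _ (Metric.mem_ball_self one_pos)⟩
  simp only [Set.mem_compl_iff, Set.mem_union, not_or] at hc
  refine ⟨z, hz, hc.1, fun w hw hwz => ⟨fun h0 => hc.2 ⟨w, Or.inl ⟨hw, h0⟩, hwz⟩,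
    fun h0 => hc.2 ⟨w, Or.inr ⟨hw, h0⟩, hwz⟩⟩⟩

theorem finite_fibre (hβ : β.IsRegular) (φ : HardySpace β) {c : ℂ}
    (hc : c ∉ value φ '' Metric.sphere 0 1)
    (hd : ∀ w ∈ Metric.ball (0 : ℂ) 1, value φ w = c → deriv (value φ) w ≠ 0) :
    {w ∈ Metric.ball (0 : ℂ) 1 | value φ w = c}.Finite := by
  obtain ⟨L, hL⟩ := exists_lipschitzOnWith_value hβ φ
  have e : {w ∈ Metric.ball (0 : ℂ) 1 | value φ w = c} =
      Metric.closedBall 0 1 ∩ value φ ⁻¹' {c} := by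
    ext w
    refine ⟨fun hw => ⟨Metric.ball_subset_closedBall hw.1, hw.2⟩, fun hw => ⟨?_, hw.2⟩⟩
    rw [← Metric.closedBall_sdiff_sphere]
    exact ⟨hw.1, fun hs => hc ⟨w, hs, hw.2⟩⟩
  have hcomp : IsCompact {w ∈ Metric.ball (0 : ℂ) 1 | value φ w = c} := by
    rw [e]
    exact (isCompact_closedBall 0 1).of_isClosed_subset
      (hL.continuousOn.preimage_isClosed_of_isClosed Metric.isClosed_closedBall isClosed_singleton)
      Set.inter_subset_left
  refine hcomp.finite (isDiscrete_iff_nhdsNE.mpr fun w hw => ?_)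
  have h1 := ((analyticOnNhd_value hβ φ) w hw.1).differentiableAt.hasDerivAt.eventually_ne
    (c := c) (hd w hw.1 hw.2)
  rw [← disjoint_iff, disjoint_principal_right]
  filter_upwards [h1] with v hv hvm using hv hvm.2

/-- If the fibre `W` of `φ` over `c` lies in the open disc and consists of simple points, then the
functions vanishing on `W` are the multiples of `φ - c`. -/
theorem exists_eq_sub_C_mul (hβ : β.IsRegular) (φ : HardySpace β) {c : ℂ} {W : Finset ℂ}
    (hc : c ∉ value φ '' Metric.sphere 0 1)
    (hW : ∀ w, w ∈ W ↔ ‖w‖ < 1 ∧ value φ w = c)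
    (hd : ∀ w ∈ W, deriv (value φ) w ≠ 0)
    (f : HardySpace β) (hf : ∀ w ∈ W, value f w = 0) :
    ∃ g : HardySpace β, f = mulL hβ φ g - c • g := by
  have hW1 : ∀ w ∈ W, ‖w‖ < 1 := fun w hw => ((hW w).mp hw).1
  set p : Polynomial ℂ := ∏ w ∈ W, (Polynomial.X - Polynomial.C w) with hp
  have hval : ∀ w : ℂ, ‖w‖ ≤ 1 →
      value ((φ - ofPolynomial (Polynomial.C c) : HardySpace β) : ℂ⟦X⟧) w = value φ w - c := by
    intro w hw
    rw [← evalL_apply hβ hw, map_sub, evalL_apply, evalL_apply, coe_ofPolynomial,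
      value_polynomial, Polynomial.eval_C]
  obtain ⟨u, hu⟩ := exists_eq_prod_mul hβ (φ - ofPolynomial (Polynomial.C c)) W hW1
    fun w hw => by rw [hval w (hW1 w hw).le, ((hW w).mp hw).2, sub_self]
  have hfac : ∀ w : ℂ, ‖w‖ ≤ 1 → value φ w = p.eval w * value u w + c := by
    intro w hw
    rw [← sub_eq_iff_eq_add, ← hval w hw, hu, coe_mulL, value_mul hβ _ _ hw, coe_ofPolynomial,
      value_polynomial]
  have hpW : ∀ w ∈ W, p.eval w = 0 := fun w hw => by
    rw [hp, Polynomial.eval_prod]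
    exact prod_eq_zero hw (by simp)
  have hunit : IsUnit (mulL hβ u) := by
    refine isUnit_mulL hβ u fun w hw huw => ?_
    have hφw : value φ w = c := by rw [hfac w hw, huw, mul_zero, zero_add]
    have hw1 : ‖w‖ < 1 := lt_of_le_of_ne hw fun h =>
      hc ⟨w, mem_sphere_zero_iff_norm.mpr h, hφw⟩
    have hwW : w ∈ W := (hW w).mpr ⟨hw1, hφw⟩
    refine hd w hwW ?_
    -- both `p` and `u` vanish at `w`, so `φ - c` has a double zero there
    have h1 : HasDerivAt (fun x => p.eval x * value u x + c)
        (p.derivative.eval w * value u w + p.eval w * deriv (value u) w) w :=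
      ((p.hasDerivAt w).mul (analyticOnNhd_value hβ u w
        (mem_ball_zero_iff.mpr hw1)).differentiableAt.hasDerivAt).add_const c
    rw [huw, hpW w hwW, mul_zero, zero_mul, add_zero] at h1
    refine (h1.congr_of_eventuallyEq ?_).deriv
    filter_upwards [Metric.isOpen_ball.mem_nhds (mem_ball_zero_iff.mpr hw1)] with x hx
    exact hfac x (mem_ball_zero_iff.mp hx).le
  obtain ⟨k, hk⟩ := exists_eq_prod_mul hβ f W hW1 hf
  obtain ⟨g, rfl⟩ := (ContinuousLinearMap.isUnit_iff_bijective.mp hunit).2 k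
  refine ⟨g, Subtype.ext ?_⟩
  have h1 := congrArg Subtype.val hu
  rw [hk]
  simp only [coe_mulL, coe_ofPolynomial, Submodule.coe_sub, Submodule.coe_smul,
    PowerSeries.smul_eq_C_mul, Polynomial.coe_C] at h1 ⊢
  linear_combination -(g : ℂ⟦X⟧) * h1

/-! ### The action of commuting compact operators on a fibre -/

/-- The Lagrange polynomial taking the value `1` at `w` and `0` at the other points of `W`. -/
def lagrange (W : Finset ℂ) (w : ℂ) : HardySpace β :=
  ofPolynomial (Lagrange.basis W id w)

theorem value_lagrange_self {w : ℂ} (hw : w ∈ W) :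
    value (lagrange W w : HardySpace β) w = 1 := by
  rw [lagrange, coe_ofPolynomial, value_polynomial]
  exact Lagrange.eval_basis_self (v := id) Function.injective_id.injOn hw

theorem value_lagrange_of_ne {v w : ℂ} (hv : v ∈ W) (hvw : w ≠ v) :
    value (lagrange W w : HardySpace β) v = 0 := by
  rw [lagrange, coe_ofPolynomial, value_polynomial]
  exact Lagrange.eval_basis_of_ne (v := id) hvw hv

/-- An operator preserving the functions that vanish on `W` acts on the values at the points of `W`
by the matrix of values of the images of the Lagrange polynomials. -/
theorem value_apply_eq_sum {W : Finset ℂ} (hW : ∀ w ∈ W, ‖w‖ ≤ 1) {K : HardySpace β →L[ℂ] HardySpace β}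
    (hβ : β.IsRegular)
    (hK : ∀ f : HardySpace β, (∀ w ∈ W, value f w = 0) → ∀ w ∈ W, value (K f) w = 0)
    (f : HardySpace β) {v : ℂ} (hv : v ∈ W) :
    value (K f) v = ∑ w ∈ W, value f w * value (K (lagrange W w)) v := by
  have h0 : ∀ u ∈ W, value ((f - ∑ w ∈ W, value f w • lagrange W w : HardySpace β) : ℂ⟦X⟧) u
      = 0 := by
    intro u hu
    rw [← evalL_apply hβ (hW u hu), map_sub, map_sum, sum_eq_single_of_mem u hu]
    · rw [map_smul, evalL_apply, evalL_apply, value_lagrange_self hu, smul_eq_mul, mul_one,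
        sub_self]
    · intro w _ hwu
      rw [map_smul, evalL_apply, value_lagrange_of_ne hu hwu, smul_zero]
  have h1 := hK _ h0 v hv
  rw [← evalL_apply hβ (hW v hv), map_sub, map_sub, map_sum, map_sum, sub_eq_zero] at h1
  simpa using h1

theorem commute_mulL (hβ : β.IsRegular) (φ g : HardySpace β) :
    Commute (mulL hβ φ) (mulL hβ g) := by
  ext f : 1
  apply Subtype.ext
  simp only [mul_apply_eq_comp, coe_mulL]
  ring

/-- A multiplication operator by a non-constant function has no eigenvalues. -/
theorem not_hasEigenvalue_mulL (hβ : β.IsRegular) {φ : HardySpace β}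
    (hφ : ¬ ∃ c, ∀ w ∈ Metric.ball (0 : ℂ) 1, value φ w = c) (c : ℂ) :
    ¬ Module.End.HasEigenvalue (mulL hβ φ : Module.End ℂ (HardySpace β)) c := by
  intro h
  obtain ⟨f, hf⟩ := h.exists_hasEigenvector
  have h1 : (φ : ℂ⟦X⟧) * f = PowerSeries.C c * (f : ℂ⟦X⟧) := by
    rw [← PowerSeries.smul_eq_C_mul]
    exact congrArg Subtype.val hf.apply_eq_smul
  have hf0 : (f : ℂ⟦X⟧) ≠ 0 := fun h0 => hf.2 (Subtype.ext h0)
  refine hφ ⟨c, fun w _ => ?_⟩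
  rw [mul_right_cancel₀ hf0 h1, ← Polynomial.coe_C, value_polynomial, Polynomial.eval_C]

/-- If `K` commutes with `M_φ` and is compact, its matrix on a fibre has zero diagonal: otherwise,
cutting down by a Lagrange polynomial gives a compact operator commuting with `M_φ` whose adjoint
has a point evaluation as eigenvector with non-zero eigenvalue. -/
theorem value_lagrange_diag_eq_zero (hβ : β.IsRegular) {φ : HardySpace β}
    (hφ : ¬ ∃ c, ∀ w ∈ Metric.ball (0 : ℂ) 1, value φ w = c) {W : Finset ℂ}
    (hW : ∀ w ∈ W, ‖w‖ ≤ 1) {K : HardySpace β →L[ℂ] HardySpace β} (hKc : IsCompactOperator K)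
    (hcomm : Commute (mulL hβ φ) K)
    (hK : ∀ f : HardySpace β, (∀ w ∈ W, value f w = 0) → ∀ w ∈ W, value (K f) w = 0)
    {w : ℂ} (hw : w ∈ W) : value (K (lagrange W w)) w = 0 := by
  by_contra h0
  set G := mulL hβ (lagrange W w) with hG
  have hLc : IsCompactOperator (K * G) := hKc.comp_clm G
  have hL : ∀ f, evalL hβ (hW w hw) ((K * G) f) =
      value (K (lagrange W w)) w * evalL hβ (hW w hw) f := by
    intro f
    rw [evalL_apply, evalL_apply, mul_apply_eq_comp, value_apply_eq_sum hW hβ hK _ hw,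
      sum_eq_single_of_mem w hw]
    · rw [hG, coe_mulL, value_mul hβ _ _ (hW w hw), value_lagrange_self hw, one_mul, mul_comm]
    · intro v hv hvw
      rw [hG, coe_mulL, value_mul hβ _ _ (hW v hv), value_lagrange_of_ne hv hvw.symm, zero_mul,
        zero_mul]
  have hε : evalL hβ (hW w hw) ≠ 0 := fun h => by
    have h1 := DFunLike.congr_fun h (lagrange W w)
    rw [evalL_apply, value_lagrange_self hw] at h1
    exact one_ne_zero h1
  obtain ⟨c, hc⟩ := exists_hasEigenvalue_of_commute hLc
    (hcomm.mul_right (commute_mulL hβ φ _)) h0 (hasEigenvalue_of_functional hLc hε h0 hL)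
  exact not_hasEigenvalue_mulL hβ hφ c hc

/-- On a generic fibre of `φ`, having a non-zero entry at `(v, w)` in the matrix of some compact
operator commuting with `M_φ` is a strict order. A non-zero `K` has only non-zero rows on the fibre,
so the order would have no extremal element, although the fibre is finite. -/
theorem eq_zero_of_commute_mulL (hβ : β.IsRegular) {φ : HardySpace β}
    (hφ : ¬ ∃ c, ∀ w ∈ Metric.ball (0 : ℂ) 1, value φ w = c)
    {K : HardySpace β →L[ℂ] HardySpace β} (hK : IsCompactOperator K)
    (hcomm : Commute (mulL hβ φ) K) : K = 0 := by
  by_contra hK0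
  obtain ⟨f₀, hf₀⟩ : ∃ f₀, K f₀ ≠ 0 := by
    by_contra! h
    exact hK0 (ContinuousLinearMap.ext h)
  obtain ⟨z, hz, hzs, hzf⟩ := exists_generic_fibre hβ φ (K f₀) hφ hf₀
  set c := value φ z
  have hfin := finite_fibre hβ φ hzs fun w hw hwz => (hzf w hw hwz).1
  set W : Finset ℂ := hfin.toFinset
  have hmem : ∀ w, w ∈ W ↔ ‖w‖ < 1 ∧ value φ w = c := fun w => by simp [W]
  have hW : ∀ w ∈ W, ‖w‖ ≤ 1 := fun w hw => ((hmem w).mp hw).1.le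
  have hfib : ∀ w ∈ W, deriv (value φ) w ≠ 0 ∧ value (K f₀) w ≠ 0 := fun w hw =>
    hzf w (mem_ball_zero_iff.mpr ((hmem w).mp hw).1) ((hmem w).mp hw).2
  have hvan : ∀ L : HardySpace β →L[ℂ] HardySpace β, Commute (mulL hβ φ) L →
      ∀ f : HardySpace β, (∀ w ∈ W, value f w = 0) → ∀ w ∈ W, value (L f) w = 0 := by
    intro L hL f hf w hw
    obtain ⟨g, rfl⟩ := exists_eq_sub_C_mul hβ φ hzs hmem (fun w hw => (hfib w hw).1) f hf
    have h1 : L (mulL hβ φ g) = mulL hβ φ (L g) := DFunLike.congr_fun hL.symm.eq g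
    rw [map_sub, map_smul, h1, ← evalL_apply hβ (hW w hw), map_sub, map_smul, evalL_apply,
      evalL_apply, coe_mulL, value_mul hβ _ _ (hW w hw), ((hmem w).mp hw).2, smul_eq_mul, sub_self]
  -- `r w v`: the entry in row `v` and column `w` is non-zero for some `L`
  let r : W → W → Prop := fun w v => ∃ L : HardySpace β →L[ℂ] HardySpace β,
    IsCompactOperator L ∧ Commute (mulL hβ φ) L ∧ value (L (lagrange W w)) v ≠ 0
  have hirr : Std.Irrefl r := ⟨fun w ⟨L, hLc, hL, hne⟩ =>
    hne (value_lagrange_diag_eq_zero hβ hφ hW hLc hL (hvan L hL) w.2)⟩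
  have htrans : IsTrans W r := ⟨by
    rintro x w v ⟨L', hLc', hL', hne'⟩ ⟨L, hLc, hL, hne⟩
    -- the Lagrange polynomial at `w` reduces the matrix product to the single path through `w`
    refine ⟨L * (mulL hβ (lagrange W w) * L'),
      hLc.comp_clm _, hL.mul_right ((commute_mulL hβ φ _).mul_right hL'), ?_⟩
    rw [mul_apply_eq_comp, value_apply_eq_sum hW hβ (hvan L hL) _ v.2,
      sum_eq_single_of_mem (w : ℂ) w.2]
    · rw [mul_apply_eq_comp, coe_mulL, value_mul hβ _ _ (hW w w.2), value_lagrange_self w.2,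
        one_mul]
      exact mul_ne_zero hne' hne
    · intro y hy hyw
      rw [mul_apply_eq_comp, coe_mulL, value_mul hβ _ _ (hW y hy),
        value_lagrange_of_ne hy hyw.symm, zero_mul, zero_mul]⟩
  have hwf : WellFounded r := Finite.wellFounded_of_trans_of_irrefl r
  obtain ⟨v, -, hv⟩ := hwf.has_min Set.univ ⟨⟨z, (hmem z).mpr ⟨mem_ball_zero_iff.mp hz, rfl⟩⟩,
    Set.mem_univ _⟩
  -- the row of `v` in the matrix of `K` is non-zero because `K f₀` does not vanish at `v`
  have hrow := (hfib v v.2).2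
  rw [value_apply_eq_sum hW hβ (hvan K hcomm) f₀ v.2] at hrow
  obtain ⟨w, hw, hne⟩ := exists_ne_zero_of_sum_ne_zero hrow
  exact hv ⟨w, hw⟩ (Set.mem_univ _) ⟨K, hK, hcomm, right_ne_zero_of_mul hne⟩

/-- For a regular weight, `M_z` is not a Lomonosov operator. -/
theorem not_isLomonosov (hβ : β.IsRegular) {Mz : HardySpace β →L[ℂ] HardySpace β}
    (hM : IsMulByZ Mz) : ¬ IsLomonosov Mz := by
  rintro ⟨S, K, hS, hK0, hK, hMS, hSK⟩
  rw [eq_mulL_of_commute hβ hM hMS] at hS hSK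
  refine hK0 (eq_zero_of_commute_mulL hβ ?_ hK hSK)
  rintro ⟨c, hc⟩
  refine hS c ?_
  have h1 : S (ofPolynomial 1) - ofPolynomial (Polynomial.C c) = 0 := by
    refine eq_zero_of_value_eq_zero hβ _ fun w hw => ?_
    rw [← evalL_apply hβ (mem_ball_zero_iff.mp hw).le, map_sub, evalL_apply, evalL_apply, hc w hw,
      coe_ofPolynomial, value_polynomial, Polynomial.eval_C, sub_self]
  rw [sub_eq_zero.mp h1]
  ext f : 1
  apply Subtype.ext
  simp [PowerSeries.smul_eq_C_mul]

end HardySpace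

/-! ### The weight `exp √n` -/

theorem sqrt_add_le_add_half {i j : ℝ} (hi : 0 ≤ i) (hij : i ≤ j) :
    √(i + j) ≤ √j + √i / 2 := by
  have h1 := Real.sq_sqrt hi
  have h2 := Real.sq_sqrt (hi.trans hij)
  have h3 := Real.sqrt_le_sqrt hij
  have h4 := Real.sqrt_nonneg i
  refine Real.sqrt_le_iff.mpr ⟨by positivity, ?_⟩
  nlinarith

theorem summable_mul_exp_neg_sqrt : Summable fun n : ℕ => n * (Real.exp √n)⁻¹ := by
  refine .of_nonneg_of_le (fun n => by positivity) (fun n => ?_)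
    ((Real.summable_nat_pow_inv (p := 2).mpr (by norm_num)).mul_left 720)
  rcases Nat.eq_zero_or_pos n with rfl | hn
  · simp
  · have hn' : (0 : ℝ) < n := Nat.cast_pos.mpr hn
    have h1 := Real.pow_div_factorial_le_exp √n (Real.sqrt_nonneg _) 6
    have h2 : √(n : ℝ) ^ 6 = (n : ℝ) ^ 3 := by
      rw [show 6 = 2 * 3 from rfl, pow_mul, Real.sq_sqrt hn'.le]
    rw [h2] at h1
    have h3 : (Real.exp √n)⁻¹ ≤ ((n : ℝ) ^ 3 / 720)⁻¹ :=
      inv_anti₀ (by positivity) (by simpa [Nat.factorial] using h1)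
    calc n * (Real.exp √n)⁻¹ ≤ n * ((n : ℝ) ^ 3 / 720)⁻¹ :=
          mul_le_mul_of_nonneg_left h3 hn'.le
      _ = _ := by field_simp

theorem sq_exp_sqrt_div_le (i j : ℕ) :
    (Real.exp √((i + j : ℕ) : ℝ) / (Real.exp √i * Real.exp √j)) ^ 2 ≤
      (Real.exp √i)⁻¹ + (Real.exp √j)⁻¹ := by
  wlog hij : i ≤ j generalizing i j
  · have h := this j i (le_of_not_ge hij)
    rwa [add_comm j i, mul_comm (Real.exp √j), add_comm (Real.exp √j)⁻¹] at h
  have h1 := sqrt_add_le_add_half (Nat.cast_nonneg (α := ℝ) i) (Nat.cast_le.mpr hij)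
  refine le_trans ?_ (le_add_of_nonneg_right (by positivity))
  rw [← Real.exp_add, ← Real.exp_sub, ← Real.exp_nat_mul, ← Real.exp_neg, Real.exp_le_exp]
  push_cast
  linarith

theorem isRegular_expSqrtWeight : expSqrtWeight.IsRegular where
  mono m n h := Real.exp_le_exp.mpr (Real.sqrt_le_sqrt (Nat.cast_le.mpr h))
  summable_mul := summable_mul_exp_neg_sqrt
  convolution := by
    have hs : Summable fun n : ℕ => (Real.exp √n)⁻¹ :=
      summable_of_summable_natCast_mul (fun n => by positivity) summable_mul_exp_neg_sqrt
    refine ⟨∑' n : ℕ, (Real.exp √n)⁻¹ + ∑' n : ℕ, (Real.exp √n)⁻¹, fun N => ?_⟩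
    have h1 : ∑ i ∈ range N.succ, (Real.exp √i)⁻¹ ≤ ∑' n : ℕ, (Real.exp √n)⁻¹ :=
      hs.sum_le_tsum _ fun _ _ => by positivity
    calc _ ≤ ∑ p ∈ antidiagonal N, ((Real.exp √p.1)⁻¹ + (Real.exp √p.2)⁻¹) := by
          refine sum_le_sum fun p hp => ?_
          rw [← mem_antidiagonal.mp hp]
          exact sq_exp_sqrt_div_le p.1 p.2
      _ ≤ _ := by
          rw [sum_add_distrib]
          refine add_le_add ?_ ?_
          · rwa [Nat.sum_antidiagonal_eq_sum_range_succ_mk]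
          · rw [← Nat.sum_antidiagonal_swap]
            rwa [Nat.sum_antidiagonal_eq_sum_range_succ_mk]
  growth r hr := by
    have hL := Real.log_pos hr
    set L := Real.log r
    have h0 : Tendsto (fun n : ℕ => Real.exp (1 / (2 * L)) * Real.exp (-(L / 2)) ^ n) atTop
        (𝓝 0) := by
      have h := (tendsto_pow_atTop_nhds_zero_of_lt_one (Real.exp_pos (-(L / 2))).le
        (by rw [Real.exp_lt_one_iff]; linarith)).const_mul (Real.exp (1 / (2 * L)))
      rwa [mul_zero] at h
    refine squeeze_zero (fun n => div_nonneg (expSqrtWeight.pos n).le (by positivity))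
      (fun n => ?_) h0
    have hr0 : r = Real.exp L := (Real.exp_log (by linarith)).symm
    change Real.exp √n / r ^ n ≤ _
    rw [hr0, ← Real.exp_nat_mul, ← Real.exp_nat_mul, ← Real.exp_sub, ← Real.exp_add,
      Real.exp_le_exp]
    -- the inequality of arithmetic and geometric means: `√n ≤ L n / 2 + 1 / (2 L)`
    have h1 : √(n : ℝ) ≤ L / 2 * n + 1 / (2 * L) := by
      have h2 := Real.sq_sqrt (Nat.cast_nonneg (α := ℝ) n)
      have h3 : L / 2 * n + 1 / (2 * L) - √(n : ℝ) = (L * √n - 1) ^ 2 / (2 * L) := by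
        rw [← h2]
        field_simp
        rw [Real.sqrt_sq (Real.sqrt_nonneg _)]
        ring
      have h4 : 0 ≤ (L * √(n : ℝ) - 1) ^ 2 / (2 * L) := by positivity
      linarith
    linarith

end

theorem theorem3p4 :
    (∀ (β : HardyWeight) (Mz : HardySpace β →L[ℂ] HardySpace β),
      IsMulByZ Mz → ¬ IsLomonosov Mz → IsOfMinimalChain Mz 3) ∧
    (∃ Mz : HardySpace expSqrtWeight →L[ℂ] HardySpace expSqrtWeight,
      IsMulByZ Mz ∧ ¬ IsLomonosov Mz ∧ IsOfMinimalChain Mz 3) := by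
  refine ⟨fun β Mz hM hL => hM.isOfMinimalChain_three hL, ?_⟩
  have hM := HardySpace.isMulByZ_mulL isRegular_expSqrtWeight
  have hL := HardySpace.not_isLomonosov isRegular_expSqrtWeight hM
  exact ⟨_, hM, hL, hM.isOfMinimalChain_three hL⟩
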